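/- An election consists of a finite set $\mathcal{C}$ of $m$ candidates, a finite nonempty set $\mathcal{V}$ of $n$ voters and, for each voter $v$, a bijective ranking $r_v : \mathcal{C} \to \{1, \dots, m\}$ (rank $1$ is the most preferred). The $1$-Borda score of a nonempty committee $T \subseteq \mathcal{C}$ is $$r_{\mathcal{V}}(T) = \frac{1}{n} \sum_{v \in \mathcal{V}} \min_{c \in T} r_v(c).$$ Greedy starts with $T_0 = \varnothing$ and, in iteration $j$, picks a candidate $c_j \in \mathcal{C} \setminus T_{j-1}$ that minimizes $r_{\mathcal{V}}(T_{j-1} \cup \{c_j\})$ and sets $T_j = T_{j-1} \cup \{c_j\}$; it outputs $T_k$ as its committee of size $k$. **Theorem.** There exist an election with $m$ candidates and an integer $k$ with $1 \le k \le m$ such that, however Greedy breaks ties, its committee $T_k$ satisfies $$r_{\mathcal{V}}(T_k) > 1.962 \cdot \frac{m+1}{k+1}.$$ -/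

import Mathlib

/-- An election with voter set `V` and candidate set `C`: every voter `v` has a bijective ranking
function `rank v : C → {1, …, m}`, `m = |C|`; smaller ranks are preferred. -/
structure Election (V C : Type) [Fintype C] where
  rank : V → C → ℕ
  rank_bijOn : ∀ v, Set.BijOn (rank v) Set.univ (Set.Icc 1 (Fintype.card C))

namespace Election

variable {V C : Type} [Fintype C]

/-- The cost `min_{c ∈ T} rank v c` of a nonempty committee `T` for the voter `v`
(the least element of a nonempty set of natural numbers; the value at `T = ∅` is never used). -/
noncomputable def cost (E : Election V C) (v : V) (T : Finset C) : ℕ :=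
  sInf (E.rank v '' (T : Set C))

/-- The `1`-Borda score of a committee: the average over the voters of the cost. -/
noncomputable def score [Fintype V] (E : Election V C) (T : Finset C) : ℝ :=
  (∑ v, (E.cost v T : ℝ)) / (Fintype.card V : ℝ)

/-- `E.IsGreedyCommittee j T`: the set `T` can be the state of Greedy after `j` iterations.
Greedy starts from `∅`; each iteration adds a candidate, among those not yet chosen, whose
addition minimizes the score. Ties may be broken in any way. -/
inductive IsGreedyCommittee [Fintype V] [DecidableEq C] (E : Election V C) :
    ℕ → Finset C → Prop
  | start : IsGreedyCommittee E 0 ∅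
  | step (j : ℕ) (T : Finset C) (c : C) (hT : IsGreedyCommittee E j T) (hc : c ∉ T)
      (hmin : ∀ c' : C, c' ∉ T → E.score (insert c T) ≤ E.score (insert c' T)) :
      IsGreedyCommittee E (j + 1) (insert c T)

end Election

/-! Every voter type is repeated for all cyclic shifts of `n` dummy candidates. With ranks divided
by `n` and `n → ∞`, a dummy saves a voter of cost `x` on average at most `x ^ 2 / 2`. Strict
inequalities in this limit model force Greedy's choices in a finite election
(`exists_election_of_placement`), so only `k` real candidates have to be designed.

The costs of the `N` voter types are `η * q ^ u`, with `u` running through a window of `N`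
consecutive levels. Each real candidate moves the worst levels, at the start of the window, to its
other end. The profile thus stays geometric and only shrinks, by the factor `y = q ^ t` for a window
starting at `t`. With `p = q ^ N`, beating the dummies means `y - y' > K * y ^ 2` for `K ≈ η * (1 +
p) / 4`. If every candidate barely does so, then `y ≈ 1 / (1 + K * k)` after `k` moves
(`exists_schedule`), and `k` times the mean cost tends to `4 * (1 - p) / ((1 + p) * (-log p))`.

This value increases to `2` as `p → 1`, but Greedy must not prefer a later candidate. The critical
rival is one full round ahead and demands `p * (1 - p ^ 2) ≤ 1 - p`, that is `p + p ^ 2 ≤ 1`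
(`IsSchedule.later_gain_lt`). The choice `p = 0.6177`, just below the inverse golden ratio, gives
about `1.9621`. -/

open Filter Topology

/-- The minimum of `a` and the first `j` values of `f`. -/
def runningMin {α : Type*} [LinearOrder α] (a : α) (f : ℕ → α) : ℕ → α
  | 0 => a
  | j + 1 => min (runningMin a f j) (f j)

/-! ### Costs and forced runs of Greedy -/

namespace Election

section General

variable {V C : Type} [Fintype C]

theorem cost_singleton (E : Election V C) (v : V) (c : C) : E.cost v {c} = E.rank v c := by
  simp [cost]

theorem cost_insert [DecidableEq C] (E : Election V C) (v : V) (c : C) {T : Finset C}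
    (hT : T.Nonempty) : E.cost v (insert c T) = min (E.rank v c) (E.cost v T) := by
  unfold cost
  rw [Finset.coe_insert, Set.image_insert_eq,
    csInf_insert (OrderBot.bddBelow _) ((Finset.coe_nonempty.2 hT).image _)]

theorem rank_le_card (E : Election V C) (v : V) (c : C) : E.rank v c ≤ Fintype.card C :=
  ((E.rank_bijOn v).mapsTo (Set.mem_univ c)).2

/-- If at each of the first `k` stages a unique candidate minimizes the score, then the state of
Greedy is determined. -/
theorem IsGreedyCommittee.eq_of_strict [Fintype V] [DecidableEq C] {E : Election V C} {k : ℕ}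
    {T : ℕ → Finset C} (h0 : T 0 = ∅)
    (hT : ∀ j < k, ∃ c ∉ T j, T (j + 1) = insert c (T j) ∧
      ∀ c' ∉ T j, c' ≠ c → E.score (insert c (T j)) < E.score (insert c' (T j)))
    {j : ℕ} {S : Finset C} (hS : E.IsGreedyCommittee j S) (hj : j ≤ k) : S = T j := by
  induction hS with
  | start => exact h0.symm
  | step j S c hS hc hmin ih =>
    obtain rfl := ih (by omega)
    obtain ⟨d, hd, hTd, hlt⟩ := hT j (by omega)
    by_cases hcd : c = d
    · rw [hTd, hcd]
    · exact absurd (hmin d hd) (not_le.2 (hlt c hc hcd))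

end General

end Election

/-! ### Elections with cyclically shifted dummy candidates -/

theorem exists_bijOn_extending (k n : ℕ) (pos : Fin k → ℕ) (hinj : Function.Injective pos)
    (hpos : ∀ i, pos i ∈ Finset.Icc 1 (k + n)) :
    ∃ g : Fin k ⊕ Fin n → ℕ, Set.BijOn g Set.univ (Set.Icc 1 (k + n)) ∧
      ∀ i, g (Sum.inl i) = pos i := by
  classical
  obtain ⟨g, hg⟩ := Finset.exists_equiv_extend_of_card_eq (α := Fin k ⊕ Fin n)
    (t := Finset.Icc 1 (k + n)) (by simp)
    (s := Finset.univ.map Function.Embedding.inl) (f := Sum.elim pos 0)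
    (by
      intro x hx
      simp only [Finset.mem_image, Finset.mem_map, Finset.mem_univ, true_and] at hx
      obtain ⟨_, ⟨i, rfl⟩, rfl⟩ := hx
      exact hpos i)
    (by
      intro a ha b hb hab
      simp only [Finset.coe_map, Set.mem_image, Finset.coe_univ, Set.mem_univ, true_and] at ha hb
      obtain ⟨i, rfl⟩ := ha
      obtain ⟨j, rfl⟩ := hb
      exact congrArg _ (hinj hab))
  refine ⟨fun c => g c, ⟨fun c _ => ?_, ?_, ?_⟩, fun i => ?_⟩
  · exact Finset.mem_Icc.1 (g c).2
  · intro a _ b _ hab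
    exact g.injective (Subtype.ext hab)
  · intro y hy
    refine ⟨g.symm ⟨y, by simpa using hy⟩, Set.mem_univ _, by simp⟩
  · exact hg (Sum.inl i) (by simp)

/-- Distinct ranks save at most what the ranks `0, …, X` would save together. This bounds the total
saving of a dummy over all shifts. -/
theorem sum_tsub_le_of_injective {ι : Type*} [Fintype ι] {p : ι → ℕ} (hp : Function.Injective p)
    (X : ℕ) : 2 * ∑ i, (X - p i) ≤ X * (X + 1) := by
  classical
  have h1 : ∑ i, (X - p i) = ∑ a ∈ Finset.univ.image p, (X - a) :=
    (Finset.sum_image (f := fun a => X - a) hp.injOn).symm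
  have h2 : ∑ a ∈ Finset.univ.image p, (X - a) ≤ ∑ a ∈ Finset.range (X + 1), (X - a) := by
    refine Finset.sum_le_sum_of_ne_zero fun a _ ha => ?_
    rw [Finset.mem_range]
    omega
  have h3 : ∑ a ∈ Finset.range (X + 1), (X - a) = ∑ a ∈ Finset.range (X + 1), a := by
    simpa using Finset.sum_range_reflect (fun a => a) (X + 1)
  have h4 := Finset.sum_range_id_mul_two (X + 1)
  simp only [Nat.add_sub_cancel] at h4
  rw [h1]
  nlinarith

/-- Each type `θ` of voters appears once for each cyclic shift of the last `n` candidates. -/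
def cyclicElection {Θ : Type} {k n : ℕ} [NeZero n] (g : Θ → Fin k ⊕ Fin n → ℕ)
    (hg : ∀ θ, Set.BijOn (g θ) Set.univ (Set.Icc 1 (k + n))) :
    Election (Θ × Fin n) (Fin k ⊕ Fin n) where
  rank v c := g v.1 (Sum.map id (v.2 + ·) c)
  rank_bijOn v := by
    have hb : Function.Bijective (Sum.map id (v.2 + ·) : Fin k ⊕ Fin n → Fin k ⊕ Fin n) :=
      (Equiv.sumCongr (Equiv.refl _) (Equiv.addLeft v.2)).bijective
    have := (hg v.1).comp hb.bijOn_univ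
    simpa [Function.comp_def] using this

/-- The committee of the first `j` candidates. -/
def initialCommittee (k n j : ℕ) : Finset (Fin k ⊕ Fin n) :=
  (Finset.univ.filter fun i : Fin k => (i : ℕ) < j).map Function.Embedding.inl

theorem initialCommittee_zero (k n : ℕ) : initialCommittee k n 0 = ∅ := by
  simp [initialCommittee]

theorem inl_mem_initialCommittee {k n j : ℕ} {i : Fin k} :
    Sum.inl i ∈ initialCommittee k n j ↔ (i : ℕ) < j := by
  simp [initialCommittee]

theorem initialCommittee_succ {k n j : ℕ} (hj : j < k) :
    initialCommittee k n (j + 1) = insert (Sum.inl ⟨j, hj⟩) (initialCommittee k n j) := by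
  ext c
  rcases c with i | d
  · simp only [inl_mem_initialCommittee, Finset.mem_insert, Sum.inl.injEq, Fin.ext_iff]
    omega
  · simp [initialCommittee]

section Cyclic

variable {Θ : Type} {k n : ℕ} [NeZero n] {g : Θ → Fin k ⊕ Fin n → ℕ}
  (hg : ∀ θ, Set.BijOn (g θ) Set.univ (Set.Icc 1 (k + n))) {pos : ℕ → Θ → ℕ}

theorem cyclicElection_cost_insert
    (hpos : ∀ θ (i : Fin k), g θ (Sum.inl i) = pos i θ)
    (v : Θ × Fin n) {j : ℕ} (hj : j ≤ k) (c : Fin k ⊕ Fin n) :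
    (cyclicElection g hg).cost v (insert c (initialCommittee k n j)) =
      min (runningMin (k + n) (pos · v.1) j) (g v.1 (Sum.map id (v.2 + ·) c)) := by
  induction j generalizing c with
  | zero =>
    have h := (cyclicElection g hg).rank_le_card v c
    rw [Fintype.card_sum, Fintype.card_fin, Fintype.card_fin] at h
    rw [initialCommittee_zero, insert_empty_eq, Election.cost_singleton]
    -- The running minimum starts at `m = k + n`, which no rank exceeds, so it drops out for the
    -- empty committee.
    exact (min_eq_right h).symm
  | succ j ih =>
    rw [initialCommittee_succ hj, Election.cost_insert _ _ _ (Finset.insert_nonempty _ _),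
      ih (by omega), min_comm]
    simp only [Sum.map_inl, id, hpos]
    rfl

variable [Fintype Θ]

theorem cyclicElection_score_inl
    (hpos : ∀ θ (i : Fin k), g θ (Sum.inl i) = pos i θ)
    {j : ℕ} (hj : j ≤ k) (l : Fin k) :
    (cyclicElection g hg).score (insert (Sum.inl l) (initialCommittee k n j)) =
      (∑ θ, (min (runningMin (k + n) (pos · θ) j) (pos l θ) : ℕ)) / (Fintype.card Θ : ℝ) := by
  have hn : (n : ℝ) ≠ 0 := Nat.cast_ne_zero.2 (NeZero.ne n)
  unfold Election.score
  simp only [cyclicElection_cost_insert hg hpos _ hj, Sum.map_inl, id, hpos, Fintype.sum_prod_type,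
    Finset.sum_const, Finset.card_univ, Fintype.card_fin, Fintype.card_prod, nsmul_eq_mul,
    ← Finset.mul_sum, Nat.cast_mul, Nat.cast_sum]
  rw [mul_comm, mul_div_mul_right _ _ hn]

/-- Over the `n` shifts the dummy `d` occupies distinct ranks of a type's ranking, so a type with
current cost `X` saves at most `X * (X + 1) / 2` in total. -/
theorem le_cyclicElection_score_inr [Nonempty Θ]
    (hpos : ∀ θ (i : Fin k), g θ (Sum.inl i) = pos i θ)
    {j : ℕ} (hj : j ≤ k) (d : Fin n) :
    (∑ θ, ((runningMin (k + n) (pos · θ) j : ℕ) - (runningMin (k + n) (pos · θ) j : ℕ) *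
        ((runningMin (k + n) (pos · θ) j : ℕ) + 1) / (2 * n) : ℝ)) / (Fintype.card Θ : ℝ) ≤
      (cyclicElection g hg).score (insert (Sum.inr d) (initialCommittee k n j)) := by
  have hn : (0 : ℝ) < n := Nat.cast_pos.2 (NeZero.pos n)
  unfold Election.score
  simp only [cyclicElection_cost_insert hg hpos _ hj, Sum.map_inr, Fintype.sum_prod_type,
    Fintype.card_fin, Fintype.card_prod, Nat.cast_mul]
  rw [mul_comm (Fintype.card Θ : ℝ), ← div_div]
  gcongr
  rw [le_div_iff₀ hn, Finset.sum_mul]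
  refine Finset.sum_le_sum fun θ _ => ?_
  generalize runningMin (k + n) (pos · θ) j = X
  have hinj : Function.Injective fun s : Fin n => g θ (Sum.inr (s + d)) := by
    intro a b hab
    have := (hg θ).injOn (Set.mem_univ _) (Set.mem_univ _) hab
    simpa using this
  have h1 := sum_tsub_le_of_injective hinj X
  have h2 : ∑ s : Fin n, min X (g θ (Sum.inr (s + d))) + ∑ s : Fin n, (X - g θ (Sum.inr (s + d)))
      = n * X := by
    rw [← Finset.sum_add_distrib, Finset.sum_congr rfl (g := fun _ => X) (fun s _ => by omega)]
    simp
  have h1' : (2 : ℝ) * ((∑ s : Fin n, (X - g θ (Sum.inr (s + d))) : ℕ) : ℝ) ≤ X * (X + 1) := by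
    exact_mod_cast h1
  have h2' : ((∑ s : Fin n, min X (g θ (Sum.inr (s + d))) : ℕ) : ℝ)
      + ((∑ s : Fin n, (X - g θ (Sum.inr (s + d))) : ℕ) : ℝ) = n * X := by
    exact_mod_cast h2
  have h3 : ((X : ℝ) - X * (X + 1) / (2 * n)) * n = n * X - X * (X + 1) / 2 := by
    field_simp
  rw [h3, ← Nat.cast_sum]
  linarith

end Cyclic

/-! ### Passage to the limit of many dummies -/

/-- The rank that approximates the relative position `a` among `n` candidates. -/
noncomputable def roundedRank (n : ℕ) (a : ℝ) : ℕ := ⌊a * n⌋₊ + 1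

theorem tendsto_roundedRank_div {a : ℝ} (ha : 0 ≤ a) :
    Tendsto (fun n : ℕ => (roundedRank n a : ℝ) / n) atTop (𝓝 a) := by
  have h1 := (tendsto_nat_floor_mul_div_atTop ha).comp (tendsto_natCast_atTop_atTop (R := ℝ))
  have h2 := h1.add (tendsto_one_div_atTop_nhds_zero_nat (𝕜 := ℝ))
  rw [add_zero] at h2
  refine h2.congr fun n => ?_
  simp [roundedRank, add_div]

theorem roundedRank_le {n : ℕ} (hn : 0 < n) {a : ℝ} (ha : a < 1) : roundedRank n a ≤ n := by
  have hn' : (0 : ℝ) < n := Nat.cast_pos.2 hn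
  have : ⌊a * n⌋₊ < n := (Nat.floor_lt' hn.ne').2 (by nlinarith)
  exact this

theorem tendsto_runningMin_roundedRank {r : ℕ → ℝ} (k : ℕ) {j : ℕ} (hr : ∀ i < j, 0 ≤ r i) :
    Tendsto (fun n : ℕ => ((runningMin (k + n) (fun i => roundedRank n (r i)) j : ℕ) : ℝ) / n) atTop
      (𝓝 (runningMin 1 r j)) := by
  induction j with
  | zero =>
    have h := (tendsto_const_div_atTop_nhds_zero_nat (k : ℝ)).add_const 1
    rw [zero_add] at h
    refine h.congr' ?_
    filter_upwards [eventually_gt_atTop 0] with n hn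
    have : (n : ℝ) ≠ 0 := Nat.cast_ne_zero.2 hn.ne'
    simp only [runningMin, Nat.cast_add]
    field_simp
  | succ j ih =>
    have h := (ih fun i hi => hr i (by omega)).min (tendsto_roundedRank_div (hr j (by omega)))
    refine h.congr fun n => ?_
    simp only [runningMin, Nat.cast_min]
    exact (min_div_div_right (Nat.cast_nonneg n) _ _)

theorem eventually_roundedRank_ne {a b : ℝ} (ha : 0 ≤ a) (hb : 0 ≤ b) (hab : a ≠ b) :
    ∀ᶠ n : ℕ in atTop, roundedRank n a ≠ roundedRank n b := by
  have h := ((tendsto_roundedRank_div ha).sub (tendsto_roundedRank_div hb)).eventually_ne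
    (sub_ne_zero.2 hab)
  filter_upwards [h] with n hn he
  exact hn (by rw [he, sub_self])

/-- A placement of `k` candidates for the voter types `Θ` at relative positions `r`, such that
Greedy strictly prefers the candidates in the given order, both to the later ones and to
candidates whose positions are equidistributed, is realized by elections. -/
theorem exists_election_of_placement {Θ : Type} [Fintype Θ] [Nonempty Θ] {k : ℕ} (hk : 1 ≤ k)
    {B : ℝ} {r : ℕ → Θ → ℝ} (hr : ∀ j < k, ∀ θ, 0 < r j θ ∧ r j θ < 1)
    (hinj : ∀ θ, ∀ i < k, ∀ j < k, r i θ = r j θ → i = j)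
    (h1 : ∀ l < k, ∀ j < l, ∑ θ, runningMin 1 (r · θ) (j + 1) <
      ∑ θ, min (runningMin 1 (r · θ) j) (r l θ))
    (h2 : ∀ j < k, ∑ θ, runningMin 1 (r · θ) (j + 1) <
      ∑ θ, (runningMin 1 (r · θ) j - runningMin 1 (r · θ) j ^ 2 / 2))
    (h3 : B < (k + 1) * ((∑ θ, runningMin 1 (r · θ) k) / Fintype.card Θ)) :
    ∃ (V C : Type) (_ : Fintype V) (_ : Nonempty V) (_ : Fintype C) (_ : DecidableEq C)
      (E : Election V C) (k : ℕ),
      1 ≤ k ∧ k ≤ Fintype.card C ∧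
        ∀ T : Finset C, E.IsGreedyCommittee k T →
          E.score T > B * (((Fintype.card C : ℝ) + 1) / ((k : ℝ) + 1)) := by
  set X : ℕ → ℕ → Θ → ℕ :=
    fun n j θ => runningMin (k + n) (fun i => roundedRank n (r i θ)) j with hX
  have tX : ∀ j ≤ k, ∀ θ, Tendsto (fun n : ℕ => (X n j θ : ℝ) / n) atTop
      (𝓝 (runningMin 1 (r · θ) j)) := fun j hj θ =>
    tendsto_runningMin_roundedRank k fun i hi => (hr i (by omega) θ).1.le
  have tp : ∀ l < k, ∀ θ, Tendsto (fun n : ℕ => (roundedRank n (r l θ) : ℝ) / n) atTop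
      (𝓝 (r l θ)) := fun l hl θ => tendsto_roundedRank_div (hr l hl θ).1.le
  have e0 : ∀ᶠ n : ℕ in atTop, ∀ θ, ∀ i ∈ Finset.range k, ∀ j ∈ Finset.range k, i ≠ j →
      roundedRank n (r i θ) ≠ roundedRank n (r j θ) := by
    rw [eventually_all]
    intro θ
    rw [eventually_all_finset]
    intro i hi
    rw [eventually_all_finset]
    intro j hj
    rw [Finset.mem_range] at hi hj
    by_cases hij : i = j
    · simp [hij]
    · filter_upwards [eventually_roundedRank_ne (hr i hi θ).1.le (hr j hj θ).1.le
        fun h => hij (hinj θ i hi j hj h)] with n hn _ using hn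
  have e1 : ∀ᶠ n : ℕ in atTop, ∀ l ∈ Finset.range k, ∀ j ∈ Finset.range l,
      ∑ θ, (X n (j + 1) θ : ℝ) / n < ∑ θ, min ((X n j θ : ℝ) / n) ((roundedRank n (r l θ) : ℝ) / n) := by
    rw [eventually_all_finset]
    intro l hl
    rw [eventually_all_finset]
    intro j hj
    rw [Finset.mem_range] at hl hj
    exact (tendsto_finsetSum _ fun θ _ => tX (j + 1) (by omega) θ).eventually_lt
      (tendsto_finsetSum _ fun θ _ => (tX j (by omega) θ).min (tp l hl θ)) (h1 l hl j hj)
  have e2 : ∀ᶠ n : ℕ in atTop, ∀ j ∈ Finset.range k, ∑ θ, (X n (j + 1) θ : ℝ) / n <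
      ∑ θ, ((X n j θ : ℝ) / n - (X n j θ : ℝ) / n * ((X n j θ : ℝ) / n + 1 / n) / 2) := by
    rw [eventually_all_finset]
    intro j hj
    rw [Finset.mem_range] at hj
    refine (tendsto_finsetSum _ fun θ _ => tX (j + 1) (by omega) θ).eventually_lt
      (tendsto_finsetSum _ fun θ _ => (tX j (by omega) θ).sub (((tX j (by omega) θ).mul
        ((tX j (by omega) θ).add (tendsto_one_div_atTop_nhds_zero_nat (𝕜 := ℝ)))).div_const 2)) ?_
    simpa [sq] using h2 j hj
  -- Since `m = k + n`, the left factor is `(m + 1) / n`: this is the desired bound, scaled by `(k +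
  -- 1) / n`.
  have e3 : ∀ᶠ n : ℕ in atTop, B * (1 + ((k : ℝ) + 1) / n) <
      (k + 1) * ((∑ θ, (X n k θ : ℝ) / n) / Fintype.card Θ) := by
    refine Tendsto.eventually_lt ((tendsto_const_nhds (x := B)).mul ((tendsto_const_nhds (x := 1)).add
      (tendsto_const_div_atTop_nhds_zero_nat ((k : ℝ) + 1)))) (((tendsto_finsetSum _ fun θ _ =>
      tX k le_rfl θ).div_const (Fintype.card Θ : ℝ)).const_mul ((k : ℝ) + 1)) ?_
    simpa using h3
  obtain ⟨n, hn, e0, e1, e2, e3⟩ :=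
    ((eventually_gt_atTop 0).and (e0.and (e1.and (e2.and e3)))).exists
  simp only [Finset.mem_range] at e0 e1 e2
  have : NeZero n := ⟨hn.ne'⟩
  have hn' : (0 : ℝ) < n := Nat.cast_pos.2 hn
  have hc : (0 : ℝ) < Fintype.card Θ := Nat.cast_pos.2 Fintype.card_pos
  have ex : ∀ θ, ∃ g : Fin k ⊕ Fin n → ℕ, Set.BijOn g Set.univ (Set.Icc 1 (k + n)) ∧
      ∀ i : Fin k, g (Sum.inl i) = roundedRank n (r i θ) := fun θ =>
    exists_bijOn_extending k n (fun i => roundedRank n (r i θ))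
      (fun i j hij => by
        by_contra hne
        exact e0 θ i i.2 j j.2 (fun h => hne (Fin.ext h)) hij)
      (fun i => Finset.mem_Icc.2 ⟨Nat.succ_pos _,
        (roundedRank_le hn (hr i i.2 θ).2).trans (Nat.le_add_left _ _)⟩)
  choose g hg hpos using ex
  have hs1 : ∀ {j : ℕ}, j ≤ k → ∀ l : Fin k, _ := fun {j} hj l => cyclicElection_score_inl hg
    (pos := fun i θ => roundedRank n (r i θ)) hpos (j := j) hj l
  have hs2 : ∀ {j : ℕ}, j ≤ k → ∀ d : Fin n, _ := fun {j} hj d => le_cyclicElection_score_inr hg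
    (pos := fun i θ => roundedRank n (r i θ)) hpos (j := j) hj d
  have hsucc : ∀ j (hj : j < k),
      (cyclicElection g hg).score (insert (Sum.inl ⟨j, hj⟩) (initialCommittee k n j)) =
        (∑ θ, (X n (j + 1) θ : ℝ)) / Fintype.card Θ := fun j hj => by
    rw [hs1 hj.le ⟨j, hj⟩, Nat.cast_sum]
    rfl
  refine ⟨Θ × Fin n, Fin k ⊕ Fin n, inferInstance, inferInstance, inferInstance, inferInstance,
    cyclicElection g hg, k, hk, by simp, fun T hT => ?_⟩
  have hTk : T = initialCommittee k n k := by
    refine hT.eq_of_strict (k := k) (initialCommittee_zero k n) (fun j hj => ?_) le_rfl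
    refine ⟨Sum.inl ⟨j, hj⟩, by simp [inl_mem_initialCommittee], initialCommittee_succ hj, ?_⟩
    rintro (l | d) hc' hne
    · have hjl : j < l := by
        rw [inl_mem_initialCommittee] at hc'
        have : (l : ℕ) ≠ j := fun h => hne (congrArg Sum.inl (Fin.ext h))
        omega
      rw [hsucc j hj, hs1 hj.le l]
      refine div_lt_div_of_pos_right ?_ hc
      have h := e1 l l.2 j hjl
      simp only [min_div_div_right hn'.le, ← Finset.sum_div] at h
      have h' := (div_lt_div_iff_of_pos_right hn').1 h
      simpa only [Nat.cast_sum, Nat.cast_min] using h'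
    · rw [hsucc j hj]
      refine lt_of_lt_of_le (div_lt_div_of_pos_right ?_ hc) (hs2 hj.le d)
      have h := mul_lt_mul_of_pos_right (e2 j hj) hn'
      rw [Finset.sum_mul, Finset.sum_mul] at h
      refine lt_of_eq_of_lt (Finset.sum_congr rfl fun θ _ => ?_)
        (lt_of_lt_of_eq h (Finset.sum_congr rfl fun θ _ => ?_))
      · field_simp
      · simp only [hX]
        field_simp
  obtain ⟨k', rfl⟩ : ∃ k', k = k' + 1 := ⟨k - 1, by omega⟩
  rw [hTk, initialCommittee_succ (Nat.lt_succ_self k'), hsucc, gt_iff_lt, ← mul_div_assoc,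
    div_lt_iff₀ (by positivity)]
  rw [← Finset.sum_div] at e3
  have h := mul_lt_mul_of_pos_right e3 hn'
  refine lt_of_eq_of_lt ?_ (lt_of_lt_of_eq h ?_)
  · simp only [Fintype.card_sum, Fintype.card_fin]
    push_cast
    field_simp
    ring
  · field_simp

/-! ### Levels of voters and the sliding window -/

/-- The first `u ≥ t` with `u ≡ θ` modulo `N`, for `θ < N`. -/
def nextVisit (N t θ : ℕ) : ℕ := θ + N * ((t + N - 1 - θ) / N)

section NextVisit

variable {N : ℕ}

theorem nextVisit_mod (t : ℕ) {θ : ℕ} (hθ : θ < N) : nextVisit N t θ % N = θ := by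
  rw [nextVisit, Nat.add_mul_mod_self_left, Nat.mod_eq_of_lt hθ]

theorem nextVisit_mem (t : ℕ) {θ : ℕ} (hθ : θ < N) :
    t ≤ nextVisit N t θ ∧ nextVisit N t θ < t + N := by
  have hd := Nat.div_add_mod (t + N - 1 - θ) N
  have hm := Nat.mod_lt (t + N - 1 - θ) (show N > 0 by omega)
  unfold nextVisit
  omega

theorem eq_of_mod_eq_of_mem {t a b : ℕ} (ha : t ≤ a) (ha' : a < t + N) (hb : t ≤ b)
    (hb' : b < t + N) (h : a % N = b % N) : a = b := by
  have h1 := Nat.div_add_mod a N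
  have h2 := Nat.div_add_mod b N
  rcases lt_trichotomy (a / N) (b / N) with h3 | h3 | h3
  · have := Nat.mul_le_mul_left N (Nat.succ_le_of_lt h3)
    rw [Nat.mul_succ] at this
    omega
  · rw [h3] at h1
    omega
  · have := Nat.mul_le_mul_left N (Nat.succ_le_of_lt h3)
    rw [Nat.mul_succ] at this
    omega

theorem nextVisit_zero {θ : ℕ} (hθ : θ < N) : nextVisit N 0 θ = θ := by
  have := nextVisit_mem 0 hθ
  exact eq_of_mod_eq_of_mem this.1 this.2 (Nat.zero_le _) (by omega)
    (by rw [nextVisit_mod 0 hθ, Nat.mod_eq_of_lt hθ])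

/-- A window start that advances by at most `N` passes each residue class at most once. -/
theorem nextVisit_step {t t' : ℕ} (h : t ≤ t') (h' : t' ≤ t + N) {θ : ℕ} (hθ : θ < N) :
    nextVisit N t' θ = if nextVisit N t θ < t' then nextVisit N t θ + N else nextVisit N t θ := by
  have h1 := nextVisit_mem t hθ
  have h2 := nextVisit_mem t' hθ
  split_ifs with hlt
  · refine eq_of_mod_eq_of_mem h2.1 h2.2 (by omega) (by omega) ?_
    rw [Nat.add_mod_right, nextVisit_mod _ hθ, nextVisit_mod _ hθ]
  · refine eq_of_mod_eq_of_mem h2.1 h2.2 (by omega) (by omega) ?_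
    rw [nextVisit_mod _ hθ, nextVisit_mod _ hθ]

theorem exists_nextVisit_eq_add {t t' : ℕ} (h : t ≤ t') (θ : ℕ) :
    ∃ n, nextVisit N t' θ = nextVisit N t θ + N * n := by
  have hle : (t + N - 1 - θ) / N ≤ (t' + N - 1 - θ) / N := Nat.div_le_div_right (by omega)
  obtain ⟨n, hn⟩ := Nat.exists_eq_add_of_le hle
  exact ⟨n, by rw [nextVisit, nextVisit, hn]; ring⟩

/-- A window of `N` consecutive levels contains each residue once; sums over voters thereby become
geometric sums. -/
theorem sum_nextVisit {M : Type*} [AddCommMonoid M] (t : ℕ) (F : ℕ → M) :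
    ∑ θ : Fin N, F (nextVisit N t θ) = ∑ u ∈ Finset.Ico t (t + N), F u := by
  have hinj : Function.Injective fun θ : Fin N => nextVisit N t θ := fun a b hab => by
    have := congrArg (· % N) hab
    simp only [nextVisit_mod t a.2, nextVisit_mod t b.2] at this
    exact Fin.ext this
  have himg : Finset.univ.image (fun θ : Fin N => nextVisit N t θ) = Finset.Ico t (t + N) := by
    refine Finset.eq_of_subset_of_card_le (fun u hu => ?_) ?_
    · obtain ⟨θ, -, rfl⟩ := Finset.mem_image.1 hu
      exact Finset.mem_Ico.2 (nextVisit_mem t θ.2)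
    · rw [Finset.card_image_of_injective _ hinj]
      simp
  rw [← himg, Finset.sum_image hinj.injOn]

theorem sum_nextVisit_ite {M : Type*} [AddCommMonoid M] {t t' : ℕ} (h' : t' ≤ t + N)
    (F : ℕ → M) :
    ∑ θ : Fin N, (if nextVisit N t θ < t' then F (nextVisit N t θ) else 0) =
      ∑ u ∈ Finset.Ico t t', F u := by
  rw [sum_nextVisit t fun u => if u < t' then F u else 0, ← Finset.sum_filter]
  congr 1
  ext u
  simp only [Finset.mem_filter, Finset.mem_Ico]
  omega

end NextVisit

/-- Voter `θ` is at level `u ≡ θ` modulo `N`, at relative position `η * q ^ u`. The candidate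
`i + 1` moves the voters whose level lies in `[t i, t (i + 1))` up by `N` levels and is near the
bottom of the rankings of all other voters. -/
noncomputable def levelPlacement (η q : ℝ) (N : ℕ) (t : ℕ → ℕ) : ℕ → Fin N → ℝ
  | 0, θ => η * q ^ (θ : ℕ)
  | i + 1, θ =>
    if nextVisit N (t i) θ < t (i + 1) then η * q ^ (nextVisit N (t i) θ + N)
    else 1 - 1 / ((i : ℝ) + 3)

section LevelPlacement

variable {η q : ℝ} {N : ℕ} {t : ℕ → ℕ}

theorem one_sub_one_div_mem (i : ℕ) :
    2 / 3 ≤ 1 - 1 / ((i : ℝ) + 3) ∧ 1 - 1 / ((i : ℝ) + 3) < 1 := by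
  have h : (0 : ℝ) ≤ i := Nat.cast_nonneg i
  have h1 : 1 / ((i : ℝ) + 3) ≤ 1 / 3 := by gcongr; linarith
  have h2 : 0 < 1 / ((i : ℝ) + 3) := by positivity
  constructor <;> linarith

theorem levelPlacement_mem (hη : 0 < η) (hη' : η ≤ 1 / 2) (hq : 0 < q) (hq' : q < 1) (i : ℕ)
    (θ : Fin N) : 0 < levelPlacement η q N t i θ ∧ levelPlacement η q N t i θ < 1 := by
  have h : ∀ u, 0 < η * q ^ u ∧ η * q ^ u < 1 := fun u => by
    have h1 : 0 < q ^ u := pow_pos hq u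
    have h2 : q ^ u ≤ 1 := pow_le_one₀ hq.le hq'.le
    exact ⟨by positivity, by nlinarith⟩
  cases i with
  | zero => exact h _
  | succ i =>
    have hi := one_sub_one_div_mem i
    simp only [levelPlacement]
    split_ifs
    · exact h _
    · exact ⟨by linarith, hi.2⟩

/-- The invariant of the construction: the occupied levels are exactly the window starting at `t j`.
Positions near the bottom are at least `2 / 3` and never improve on a cost `η * q ^ u ≤ 1 / 2`. -/
theorem runningMin_levelPlacement (hη : 0 < η) (hη' : η ≤ 1 / 2) (hq : 0 < q) (hq' : q < 1)
    (ht0 : t 0 = 0) (ht : StrictMono t) (htN : ∀ i, t (i + 1) ≤ t i + N) (j : ℕ) (θ : Fin N) :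
    runningMin 1 (levelPlacement η q N t · θ) (j + 1) = η * q ^ nextVisit N (t j) θ := by
  induction j with
  | zero =>
    rw [ht0, nextVisit_zero θ.2]
    have h1 : q ^ (θ : ℕ) ≤ 1 := pow_le_one₀ hq.le hq'.le
    exact min_eq_right (show η * q ^ (θ : ℕ) ≤ 1 by nlinarith)
  | succ j ih =>
    rw [runningMin, ih, levelPlacement, nextVisit_step (ht.monotone j.le_succ) (htN j) θ.2]
    split_ifs
    · refine min_eq_right (mul_le_mul_of_nonneg_left ?_ hη.le)
      exact pow_le_pow_of_le_one hq.le hq'.le (Nat.le_add_right _ _)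
    · have h1 : q ^ nextVisit N (t j) θ ≤ 1 := pow_le_one₀ hq.le hq'.le
      have h2 := one_sub_one_div_mem j
      exact min_eq_left (by nlinarith)

/-- Successive levels of one voter strictly increase, bottom positions are told apart by the term `1
/ (i + 3)`, and the two kinds are separated by the gap between `1 / 2` and `2 / 3`. -/
theorem levelPlacement_injective (hN : 0 < N) (hη : 0 < η) (hη' : η ≤ 1 / 2) (hq : 0 < q)
    (hq' : q < 1) (ht : StrictMono t) (θ : Fin N) {i j : ℕ}
    (h : levelPlacement η q N t i θ = levelPlacement η q N t j θ) : i = j := by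
  have hpow : ∀ u v, η * q ^ u = η * q ^ v → u = v := fun u v huv =>
    (pow_right_strictAnti₀ hq hq').injective (mul_left_cancel₀ hη.ne' huv)
  have hlow : ∀ (u i : ℕ), η * q ^ u ≠ 1 - 1 / ((i : ℝ) + 3) := fun u i h => by
    have h1 : q ^ u ≤ 1 := pow_le_one₀ hq.le hq'.le
    have h2 := one_sub_one_div_mem i
    nlinarith
  have hzero : ∀ i, levelPlacement η q N t 0 θ ≠ levelPlacement η q N t (i + 1) θ := by
    intro i h
    simp only [levelPlacement] at h
    split_ifs at h
    · have h1 := hpow _ _ h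
      have h2 := nextVisit_mod (t i) θ.2
      have h3 : (θ : ℕ) ≤ nextVisit N (t i) θ := Nat.le_add_right _ _
      omega
    · exact hlow _ _ h
  have hlt : ∀ i j, i < j →
      levelPlacement η q N t (i + 1) θ ≠ levelPlacement η q N t (j + 1) θ := by
    intro i j hij h
    simp only [levelPlacement] at h
    split_ifs at h with h1 h2 h2
    · have h3 := hpow _ _ h
      have h4 := ht.monotone (Nat.succ_le_of_lt hij)
      have h5 := (nextVisit_mem (t j) θ.2).1
      simp only [Nat.succ_eq_add_one] at h4
      omega
    · exact hlow _ _ h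
    · exact hlow _ _ h.symm
    · have h3 : (i : ℝ) < j := Nat.cast_lt.2 hij
      have h4 : 1 / ((j : ℝ) + 3) < 1 / ((i : ℝ) + 3) := by gcongr
      linarith
  rcases i with _ | i <;> rcases j with _ | j
  · rfl
  · exact absurd h (hzero j)
  · exact absurd h.symm (hzero i)
  · rcases lt_trichotomy i j with hij | hij | hij
    · exact absurd h (hlt i j hij)
    · rw [hij]
    · exact absurd h.symm (hlt j i hij)

end LevelPlacement

/-! ### Savings as geometric sums -/

section Gains

variable {η q : ℝ} {N : ℕ} {t : ℕ → ℕ}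

/-- The gain from moving the voters with levels in `[t, t')` up by `N` levels. -/
theorem one_sub_mul_sum_level_sub (t t' : ℕ) (htt : t ≤ t') (htN : t' ≤ t + N) :
    (1 - q) * ∑ θ : Fin N, (η * q ^ nextVisit N t θ - η * q ^ nextVisit N t' θ) =
      η * (1 - q ^ N) * (q ^ t - q ^ t') := by
  have h : ∀ θ : Fin N, η * q ^ nextVisit N t θ - η * q ^ nextVisit N t' θ =
      η * (1 - q ^ N) * if nextVisit N t θ < t' then q ^ nextVisit N t θ else 0 := fun θ => by
    rw [nextVisit_step htt htN θ.2]
    split_ifs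
    · rw [pow_add]; ring
    · ring
  rw [Finset.sum_congr rfl fun θ _ => h θ, ← Finset.mul_sum,
    sum_nextVisit_ite htN fun u => q ^ u, ← geom_sum_Ico_mul_neg q htt]
  ring

theorem one_sub_mul_sum_level (t : ℕ) :
    (1 - q) * ∑ θ : Fin N, η * q ^ nextVisit N t θ = η * (1 - q ^ N) * q ^ t := by
  rw [sum_nextVisit t fun u => η * q ^ u, ← Finset.mul_sum]
  have := geom_sum_Ico_mul_neg q (Nat.le_add_right t N)
  rw [pow_add] at this
  linear_combination η * this

theorem one_sub_sq_mul_sum_level_sq (t : ℕ) :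
    (1 - q ^ 2) * ∑ θ : Fin N, (η * q ^ nextVisit N t θ) ^ 2 =
      η ^ 2 * (1 - (q ^ N) ^ 2) * (q ^ t) ^ 2 := by
  rw [sum_nextVisit t fun u => (η * q ^ u) ^ 2]
  have h : ∀ u, (η * q ^ u) ^ 2 = η ^ 2 * (q ^ 2) ^ u := fun u => by
    rw [mul_pow, ← pow_mul, ← pow_mul, mul_comm u]
  simp only [h]
  rw [← Finset.mul_sum]
  have := geom_sum_Ico_mul_neg (q ^ 2) (Nat.le_add_right t N)
  rw [pow_add, ← pow_mul, ← pow_mul, mul_comm 2 t, mul_comm 2 N, pow_mul, pow_mul] at this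
  linear_combination η ^ 2 * this

/-- The gain of a later candidate `i + 1` for the voters at levels in `[s, s + N)`, when these are
at most `n` rounds behind. -/
theorem one_sub_mul_sum_level_sub_min_le (hη : 0 < η) (hη' : η ≤ 1 / 2) (hq : 0 < q) (hq' : q < 1)
    {i s n : ℕ} (hs : s ≤ t i) (ht : t i ≤ t (i + 1)) (htN : t (i + 1) ≤ t i + N)
    (hn : t (i + 1) ≤ s + N * (n + 1)) :
    (1 - q) * (q ^ N) ^ n * ∑ θ : Fin N, (η * q ^ nextVisit N s θ -
        min (η * q ^ nextVisit N s θ) (levelPlacement η q N t (i + 1) θ)) ≤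
      η * (1 - q ^ N * (q ^ N) ^ n) * (q ^ t i - q ^ t (i + 1)) := by
  have hP : 0 < (q ^ N) ^ n := by positivity
  have hPp : q ^ N * (q ^ N) ^ n ≤ 1 :=
    mul_le_one₀ (pow_le_one₀ hq.le hq'.le) hP.le (pow_le_one₀ (by positivity) (pow_le_one₀ hq.le hq'.le))
  have h : ∀ θ : Fin N, (q ^ N) ^ n * (η * q ^ nextVisit N s θ -
      min (η * q ^ nextVisit N s θ) (levelPlacement η q N t (i + 1) θ)) ≤
      η * (1 - q ^ N * (q ^ N) ^ n) *
        if nextVisit N (t i) θ < t (i + 1) then q ^ nextVisit N (t i) θ else 0 := fun θ => by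
    simp only [levelPlacement]
    split_ifs with hlt
    · obtain ⟨m, hm⟩ := exists_nextVisit_eq_add (N := N) hs θ
      have hs' := (nextVisit_mem s θ.2).1
      have hmn : m ≤ n := by
        have h1 : N * m < N * (n + 1) := by omega
        exact Nat.lt_succ_iff.1 (lt_of_mul_lt_mul_left h1 (Nat.zero_le _))
      -- A voter `m ≤ n` rounds behind has a cost larger by at most the factor `(q ^ N) ^ (-n)`.
      have h2 : q ^ nextVisit N s θ * (q ^ N) ^ n ≤ q ^ nextVisit N (t i) θ := by
        rw [hm, pow_add, pow_mul]
        exact mul_le_mul_of_nonneg_left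
          (pow_le_pow_of_le_one (by positivity) (pow_le_one₀ hq.le hq'.le) hmn) (by positivity)
      have h3 : q ^ (nextVisit N (t i) θ + N) ≤ q ^ nextVisit N s θ :=
        pow_le_pow_of_le_one hq.le hq'.le (by omega)
      rw [min_eq_right (mul_le_mul_of_nonneg_left h3 hη.le), pow_add]
      nlinarith
    · have h1 : q ^ nextVisit N s θ ≤ 1 := pow_le_one₀ hq.le hq'.le
      have h2 := one_sub_one_div_mem i
      rw [min_eq_left (by nlinarith)]
      simp
  have h' := Finset.sum_le_sum fun θ (_ : θ ∈ Finset.univ) => h θ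
  rw [← Finset.mul_sum, ← Finset.mul_sum, sum_nextVisit_ite htN fun u => q ^ u] at h'
  have h'' := mul_le_mul_of_nonneg_left h' (sub_nonneg.2 hq'.le)
  rw [← geom_sum_Ico_mul_neg q ht]
  linarith

end Gains

/-! ### Schedules and Greedy's choices -/

/-- Cursor positions `t` along the levels for which Greedy picks the candidates of
`levelPlacement η q N t` in order. The share `1 - q ^ (t (i + 1) - t i)` of the mean cost that
candidate `i + 1` saves has to be slightly above `K` times the mean cost. -/
structure IsSchedule (q : ℝ) (N k : ℕ) (t : ℕ → ℕ) (K c : ℝ) : Prop where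
  zero : t 0 = 0
  strictMono : StrictMono t
  two_mul_step_lt : ∀ i, 2 * (t (i + 1) - t i) < N
  step_antitone : Antitone fun i => t (i + 1) - t i
  lt_gain : ∀ i, K * (q ^ t i) ^ 2 < q ^ t i - q ^ t (i + 1)
  gain_le : ∀ i < k, q ^ t i - q ^ t (i + 1) ≤ c * K * (q ^ t i) ^ 2

/-- Write `p = q ^ N`, `P = p ^ n`. Voters up to `n` rounds behind inflate the saving of candidate
`i + 1` by at most `(1 - p * P) / ((1 - p) * P)`. The savings are nearly `K * y ^ 2`, and `y` has
shrunk by about `P` between `j` and `i`, so it suffices that `(1 - p * P) * P` is below `1 - p` up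
to the margins in `c` and `K`. -/
theorem IsSchedule.later_gain_lt {q K c : ℝ} {N k : ℕ} {t : ℕ → ℕ} (hq : 0 < q) (hq' : q < 1)
    (hK : 0 < K) (hc : 0 < c) (hcK : c * K < 1) (h : IsSchedule q N k t K c)
    (hp : 2 * (q ^ N) ^ 2 ≤ 1)
    (hpc : c * (q ^ N - (q ^ N) ^ 3) ≤ (1 - q ^ N) * (1 - c * K) ^ 2) {i j n : ℕ} (hji : j < i)
    (hik : i < k) (hn : t j + N * n ≤ t (i + 1)) :
    (1 - q ^ N * (q ^ N) ^ n) * (q ^ t i - q ^ t (i + 1)) <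
      (1 - q ^ N) * (q ^ N) ^ n * (q ^ t j - q ^ t (j + 1)) := by
  have hp0 : 0 < q ^ N := by positivity
  have hN : N ≠ 0 := by
    rintro rfl
    simp only [pow_zero] at hp
    linarith
  have hp1 : q ^ N < 1 := pow_lt_one₀ hq.le hq' hN
  have hyi : 0 < q ^ t i := by positivity
  have hyi1 : q ^ t i ≤ 1 := pow_le_one₀ hq.le hq'.le
  have hyj : 0 < q ^ t j := by positivity
  rcases Nat.eq_zero_or_pos n with rfl | hn0
  -- Less than a full round ahead: both the scale `q ^ t` and the saved share decrease along the
  -- schedule.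
  · simp only [pow_zero, mul_one]
    refine mul_lt_mul_of_pos_left ?_ (sub_pos.2 hp1)
    have hstep : ∀ l, q ^ t l - q ^ t (l + 1) = q ^ t l * (1 - q ^ (t (l + 1) - t l)) := fun l => by
      rw [mul_sub, ← pow_add, Nat.add_sub_cancel' (h.strictMono l.lt_succ_self).le, mul_one]
    have hw : q ^ (t (j + 1) - t j) ≤ q ^ (t (i + 1) - t i) :=
      pow_le_pow_of_le_one hq.le hq'.le (h.step_antitone hji.le)
    have hlt : q ^ t i < q ^ t j := pow_lt_pow_right_of_lt_one₀ hq hq' (h.strictMono hji)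
    have hw1 : q ^ (t (i + 1) - t i) < 1 :=
      pow_lt_one₀ hq.le hq' (Nat.sub_pos_of_lt (h.strictMono i.lt_succ_self)).ne'
    rw [hstep, hstep]
    nlinarith
  · set p := q ^ N with hpdef
    set P := p ^ n with hPdef
    have hP : 0 < P := by positivity
    have hPp : P ≤ p := pow_le_of_le_one hp0.le hp1.le hn0.ne'
    have hpP : 0 ≤ 1 - p * P := by nlinarith
    have hnext : q ^ t (i + 1) ≤ q ^ t j * P := by
      rw [hPdef, hpdef, ← pow_mul, ← pow_add]
      exact pow_le_pow_of_le_one hq.le hq'.le hn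
    have hgi := h.gain_le i hik
    have hgj := h.lt_gain j
    have hcK0 : 0 < c * K := mul_pos hc hK
    have hb : 0 < 1 - c * K := sub_pos.2 hcK
    have h1 : q ^ t i * (1 - c * K) ≤ q ^ t j * P := by
      nlinarith [mul_le_mul_of_nonneg_left hyi1 (mul_pos hcK0 hyi).le]
    have h2 : (q ^ t i * (1 - c * K)) ^ 2 ≤ (q ^ t j * P) ^ 2 :=
      pow_le_pow_left₀ (by positivity) h1 2
    -- The worst case is `n = 1`: `(1 - p * P) * P` increases in `P` on `[0, p]` because `2 * p ^ 2
    -- ≤ 1`.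
    have h3 : (1 - p * P) * P ≤ p - p ^ 3 := by
      nlinarith [mul_nonneg (sub_nonneg.2 hPp) (show 0 ≤ 1 - p * (p + P) by nlinarith)]
    refine lt_of_mul_lt_mul_right ?_ (sq_nonneg (1 - c * K))
    calc (1 - p * P) * (q ^ t i - q ^ t (i + 1)) * (1 - c * K) ^ 2
        ≤ (1 - p * P) * (c * K * (q ^ t i) ^ 2) * (1 - c * K) ^ 2 := by gcongr
      _ = (1 - p * P) * (c * K) * (q ^ t i * (1 - c * K)) ^ 2 := by ring
      _ ≤ (1 - p * P) * (c * K) * (q ^ t j * P) ^ 2 := by gcongr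
      _ = P * K * (q ^ t j) ^ 2 * (c * ((1 - p * P) * P)) := by ring
      _ ≤ P * K * (q ^ t j) ^ 2 * (c * (p - p ^ 3)) := by gcongr
      _ ≤ P * K * (q ^ t j) ^ 2 * ((1 - p) * (1 - c * K) ^ 2) := by gcongr
      _ = (1 - p) * P * (1 - c * K) ^ 2 * (K * (q ^ t j) ^ 2) := by ring
      _ < (1 - p) * P * (1 - c * K) ^ 2 * (q ^ t j - q ^ t (j + 1)) := by
        have : 0 < (1 - p) * P * (1 - c * K) ^ 2 := by
          have := sub_pos.2 hp1
          positivity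
        gcongr
      _ = (1 - p) * P * (q ^ t j - q ^ t (j + 1)) * (1 - c * K) ^ 2 := by ring

theorem IsSchedule.exists_election {η q K c B : ℝ} {N k : ℕ} {t : ℕ → ℕ} (hη : 0 < η)
    (hη' : η ≤ 1 / 4) (hq : 0 < q) (hq' : q < 1) (hN : 0 < N) (hK : 0 < K) (hc : 0 < c)
    (hcK : c * K < 1) (h : IsSchedule q N k t K c) (hKη : η * (1 + q ^ N) ≤ 2 * (1 + q) * K)
    (hp : 2 * (q ^ N) ^ 2 ≤ 1)
    (hpc : c * (q ^ N - (q ^ N) ^ 3) ≤ (1 - q ^ N) * (1 - c * K) ^ 2)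
    (hB : B * (N * (1 - q)) < (k + 2) * (η * (1 - q ^ N) * q ^ t k)) :
    ∃ (V C : Type) (_ : Fintype V) (_ : Nonempty V) (_ : Fintype C) (_ : DecidableEq C)
      (E : Election V C) (k : ℕ),
      1 ≤ k ∧ k ≤ Fintype.card C ∧
        ∀ T : Finset C, E.IsGreedyCommittee k T →
          E.score T > B * (((Fintype.card C : ℝ) + 1) / ((k : ℝ) + 1)) := by
  have hη2 : η ≤ 1 / 2 := by linarith
  have hmono := h.strictMono.monotone
  have htN : ∀ i, t (i + 1) ≤ t i + N := fun i => by
    have := h.two_mul_step_lt i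
    omega
  have hN' : (0 : ℝ) < N := Nat.cast_pos.2 hN
  have hq1 : 0 < 1 - q := sub_pos.2 hq'
  have hrm := runningMin_levelPlacement hη hη2 hq hq' h.zero h.strictMono htN
  have hy : ∀ u : ℕ, 0 < q ^ u := fun u => pow_pos hq u
  have hy1 : ∀ u : ℕ, q ^ u ≤ 1 := fun u => pow_le_one₀ hq.le hq'.le
  have hp1 : q ^ N < 1 := pow_lt_one₀ hq.le hq' hN.ne'
  have : Nonempty (Fin N) := ⟨⟨0, hN⟩⟩
  refine exists_election_of_placement (Θ := Fin N) (k := k + 1) (by omega)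
    (r := levelPlacement η q N t) (fun j _ θ => levelPlacement_mem hη hη2 hq hq' j θ)
    (fun θ i _ j _ hij => levelPlacement_injective hN hη hη2 hq hq' h.strictMono θ hij)
    (fun l hl j hj => ?_) (fun j _ => ?_) ?_
  · obtain ⟨i, rfl⟩ : ∃ i, l = i + 1 := ⟨l - 1, by omega⟩
    cases j with
    | zero =>
      simp only [hrm]
      -- At the first stage a later candidate is near the top for fewer than half of the voters and
      -- costs the others at least `2 / 3`. Its mean cost exceeds `1 / 3`, against at most `η ≤ 1 /
      -- 4`.
      have hr : ∀ θ : Fin N, 2 / 3 ≤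
          min (runningMin 1 (levelPlacement η q N t · θ) 0) (levelPlacement η q N t (i + 1) θ) +
            if nextVisit N (t i) θ < t (i + 1) then 2 / 3 else 0 := fun θ => by
        have h1 := levelPlacement_mem (t := t) hη hη2 hq hq' (i + 1) θ
        have h2 := one_sub_one_div_mem i
        rw [runningMin, min_eq_right h1.2.le]
        split_ifs with hlt
        · linarith
        · rw [levelPlacement, if_neg hlt]
          linarith
      have hl : ∀ θ : Fin N, η * q ^ nextVisit N (t 0) θ ≤ 1 / 4 := fun θ => by
        have := hy1 (nextVisit N (t 0) θ)
        have := hy (nextVisit N (t 0) θ)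
        nlinarith
      have h1 := Finset.sum_le_sum fun θ (_ : θ ∈ Finset.univ) => hr θ
      have h2 := Finset.sum_le_sum fun θ (_ : θ ∈ Finset.univ) => hl θ
      rw [Finset.sum_add_distrib, sum_nextVisit_ite (htN i) fun _ => (2 / 3 : ℝ)] at h1
      simp only [Finset.sum_const, Finset.card_univ, Fintype.card_fin, Nat.card_Ico,
        nsmul_eq_mul] at h1 h2
      have h3 : (2 * ((t (i + 1) - t i : ℕ) : ℝ)) < N := by exact_mod_cast h.two_mul_step_lt i
      linarith
    | succ j =>
      simp only [hrm]
      have hji : j < i := by omega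
      have hti := h.strictMono i.lt_succ_self
      have htji := h.strictMono hji
      simp only [Nat.succ_eq_add_one] at hti
      -- The subtracted `1` makes `t j + N * n < t (i + 1) ≤ t j + N * (n + 1)`, as the two gain
      -- lemmas need.
      set n := (t (i + 1) - 1 - t j) / N with hn
      have hdiv := Nat.div_add_mod (t (i + 1) - 1 - t j) N
      have hmod := Nat.mod_lt (t (i + 1) - 1 - t j) hN
      rw [← hn] at hdiv
      have hP : 0 < (q ^ N) ^ n := by positivity
      have hG := one_sub_mul_sum_level_sub_min_le (n := n) hη hη2 hq hq' htji.le hti.le (htN i)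
        (by rw [Nat.mul_succ]; omega)
      have hD := one_sub_mul_sum_level_sub (η := η) (q := q) _ _ (hmono j.le_succ) (htN j)
      simp only [Nat.succ_eq_add_one] at hD
      rw [Finset.sum_sub_distrib] at hG hD
      have hmain := h.later_gain_lt hq hq' hK hc hcK hp hpc hji (by omega)
        (show t j + N * n ≤ t (i + 1) by omega)
      have h1 := mul_lt_mul_of_pos_left hmain hη
      have h2 : 0 < (1 - q) * (q ^ N) ^ n := mul_pos hq1 hP
      refine sub_lt_sub_iff_left (∑ θ : Fin N, η * q ^ nextVisit N (t j) θ) |>.1 ?_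
      refine lt_of_mul_lt_mul_left ?_ h2.le
      linear_combination hG + h1 - (q ^ N) ^ n * hD
  · cases j with
    | zero =>
      simp only [hrm]
      -- At the first stage a dummy has mean cost `1 / 2`, more than `η`.
      refine Finset.sum_lt_sum_of_nonempty Finset.univ_nonempty fun θ _ => ?_
      have := hy1 (nextVisit N (t 0) θ)
      simp only [runningMin]
      nlinarith
    | succ j =>
      simp only [hrm]
      have h1 := one_sub_mul_sum_level_sub (η := η) (q := q) _ _ (hmono j.le_succ) (htN j)
      have h2 := one_sub_sq_mul_sum_level_sq (N := N) (η := η) (q := q) (t j)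
      have h3 := h.lt_gain j
      simp only [Nat.succ_eq_add_one] at h1
      rw [Finset.sum_sub_distrib] at h1 ⊢
      rw [← Finset.sum_div]
      generalize ∑ θ : Fin N, η * q ^ nextVisit N (t j) θ = S at *
      generalize ∑ θ : Fin N, η * q ^ nextVisit N (t (j + 1)) θ = S' at *
      generalize ∑ θ : Fin N, (η * q ^ nextVisit N (t j) θ) ^ 2 = Q at *
      -- The factor `1 - q ^ 2` clears the denominators of both geometric sums.
      suffices hs : 0 < (1 - q ^ 2) * (S - S' - Q / 2) by
        have := (mul_pos_iff_of_pos_left (show 0 < 1 - q ^ 2 by nlinarith)).1 hs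
        linarith
      have h4 : (1 - q ^ 2) * (S - S' - Q / 2) = η * (1 - q ^ N) *
          ((1 + q) * (q ^ t j - q ^ t (j + 1)) - η * (1 + q ^ N) * (q ^ t j) ^ 2 / 2) := by
        linear_combination (1 + q) * h1 - h2 / 2
      rw [h4]
      have h5 : 0 < η * (1 - q ^ N) := mul_pos hη (sub_pos.2 hp1)
      refine mul_pos h5 ?_
      have h6 := mul_lt_mul_of_pos_left h3 (show 0 < 1 + q by linarith)
      have h7 := mul_le_mul_of_nonneg_right hKη (sq_nonneg (q ^ t j))
      linarith
  · simp only [hrm, Fintype.card_fin]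
    rw [← mul_div_assoc, lt_div_iff₀ hN']
    have h1 := one_sub_mul_sum_level (N := N) (η := η) (q := q) (t k)
    refine lt_of_mul_lt_mul_left ?_ hq1.le
    push_cast
    linear_combination hB - (k + 2 : ℝ) * h1

/-- Each step is the least one that beats the dummies, so it overshoots by at most `1 - q`, which
the slack `c - 1` absorbs while `y = q ^ t i` is not too small. Then `1 / y` grows by at most `c * K
/ (1 - c * K) ≤ K'` per step. -/
theorem exists_schedule {q K c K' : ℝ} {N k : ℕ} (hq' : q < 1) (hK : 0 < K) (hKq : K < q)
    (hN : q ^ N < (q - K) ^ 2) (hc : 1 < c) (hcK : 2 * (c * K) ≤ 1)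
    (hK' : c * K * (1 + K') ≤ K') (hqk : (1 - q) * (1 + K' * k) ≤ (c - 1) * K) :
    ∃ t, IsSchedule q N k t K c ∧ 1 ≤ (1 + K' * k) * q ^ t k := by
  classical
  have hq : 0 < q := hK.trans hKq
  have hy1 : ∀ u : ℕ, q ^ u ≤ 1 := fun u => pow_le_one₀ hq.le hq'.le
  have hy : ∀ u : ℕ, 0 < q ^ u := fun u => pow_pos hq u
  have hcK0 : 0 < c * K := mul_pos (by linarith) hK
  have hK'0 : 0 < K' := by
    have : c * K ≤ K' * (1 - c * K) := by linarith
    nlinarith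
  have hex : ∀ s, ∃ w, K * q ^ s < 1 - q ^ w := fun s => by
    have h1 : K * q ^ s < 1 := by nlinarith [hy1 s, hy s]
    obtain ⟨w, hw⟩ := exists_pow_lt_of_lt_one (sub_pos.2 h1) hq'
    exact ⟨w, by linarith⟩
  set w : ℕ → ℕ := fun s => Nat.find (hex s) with hw
  have hspec : ∀ s, K * q ^ s < 1 - q ^ w s := fun s => Nat.find_spec (hex s)
  have hpos : ∀ s, 0 < w s := fun s => by
    rw [Nat.pos_iff_ne_zero]
    intro h0
    have h1 := hspec s
    rw [h0, pow_zero, sub_self] at h1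
    exact absurd h1 (not_lt.2 (mul_pos hK (hy s)).le)
  have hle : ∀ s, 1 - q ^ w s ≤ K * q ^ s + (1 - q) := fun s => by
    obtain ⟨v, hv⟩ : ∃ v, w s = v + 1 := ⟨w s - 1, by have := hpos s; omega⟩
    have h1 : ¬ K * q ^ s < 1 - q ^ v := Nat.find_min (hex s) (show v < w s by omega)
    rw [hv, pow_succ]
    nlinarith [hy1 v, hy v]
  have hanti : Antitone w := fun s s' hss => by
    refine Nat.find_min' (hex s') (lt_of_le_of_lt ?_ (hspec s))
    exact mul_le_mul_of_nonneg_left (pow_le_pow_of_le_one hq.le hq'.le hss) hK.le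
  have htwo : ∀ s, 2 * w s < N := fun s => by
    by_contra! hcon
    have h1 : q ^ (2 * w s) ≤ q ^ N := pow_le_pow_of_le_one hq.le hq'.le hcon
    -- Minimality bounds even the largest step, so two steps together stay within a round because `q
    -- ^ N < (q - K) ^ 2`.
    have h2 : q - K ≤ q ^ w s := by nlinarith [hle s, hy1 s]
    have h3 := pow_le_pow_left₀ (sub_nonneg.2 hKq.le) h2 2
    rw [← pow_mul, mul_comm (w s)] at h3
    linarith
  let t : ℕ → ℕ := fun i => (fun s => s + w s)^[i] 0
  have hts : ∀ i, t (i + 1) = t i + w (t i) := fun i => Function.iterate_succ_apply' _ _ _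
  have htsub : ∀ i, t (i + 1) - t i = w (t i) := fun i => by rw [hts]; omega
  have hmono : StrictMono t := strictMono_nat_of_lt_succ fun i => by
    have := hpos (t i)
    rw [hts]
    omega
  have hgain : ∀ i, q ^ t i - q ^ t (i + 1) = q ^ t i * (1 - q ^ w (t i)) := fun i => by
    rw [hts, pow_add]
    ring
  have hstep : ∀ i ≤ k, 1 ≤ (1 + K' * i) * q ^ t i →
      q ^ t i - q ^ t (i + 1) ≤ c * K * (q ^ t i) ^ 2 := fun i hi h1 => by
    have h2 : (1 + K' * i) * q ^ t i ≤ (1 + K' * k) * q ^ t i := by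
      have := hy (t i)
      gcongr
    have h3 : 1 - q ≤ (c - 1) * K * q ^ t i := by
      have h4 := mul_le_mul_of_nonneg_left (h1.trans h2) (sub_pos.2 hq').le
      have h5 := mul_le_mul_of_nonneg_right hqk (hy (t i)).le
      linarith
    rw [hgain]
    nlinarith [hle (t i), hy (t i)]
  have hbound : ∀ i ≤ k, 1 ≤ (1 + K' * i) * q ^ t i := fun i => by
    induction i with
    | zero => intro _; simp [t]
    | succ i ih =>
      intro hi
      have h1 := ih (by omega)
      have h2 := hstep i (by omega) h1
      have hi0 : (0 : ℝ) ≤ K' * i := by positivity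
      rw [show 1 + K' * ((i + 1 : ℕ) : ℝ) = 1 + K' * i + K' by push_cast; ring]
      generalize K' * (i : ℝ) = a at *
      have hya := hy (t i)
      have hyb := hy1 (t i)
      generalize q ^ t i = y at *
      -- The bound `1 / y' ≤ 1 / y + K'` is carried out without division, with `a = K' * i`.
      have h3 : y * (1 - c * K * y) ≤ q ^ t (i + 1) := by linarith
      have h4 : (1 + a + K') * (y * (1 - c * K * y)) ≤ (1 + a + K') * q ^ t (i + 1) := by gcongr
      have h5 : 0 ≤ ((1 + a) * y - 1) * (1 - c * K * y) :=
        mul_nonneg (by linarith) (by nlinarith)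
      have h6 : 0 ≤ y * (K' - c * K - c * K * K' * y) := by
        refine mul_nonneg hya.le ?_
        nlinarith [mul_pos hcK0 hK'0]
      linarith
  exact ⟨t, ⟨rfl, hmono, fun i => htsub i ▸ htwo _, fun i j hij => by
    simp only [htsub]; exact hanti (hmono.monotone hij), fun i => by
    rw [hgain]; nlinarith [hspec (t i), hy (t i)], fun i hi => hstep i hi.le (hbound i hi.le)⟩,
    hbound k le_rfl⟩

/-! ### Numerical choices -/

theorem one_le_exp_mul : (1 : ℝ) ≤ Real.exp 0.48176 * 0.6177 := by
  have h := Real.sum_le_exp_of_nonneg (x := 0.48176) (by norm_num) 8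
  norm_num [Finset.sum_range_succ, Nat.factorial] at h ⊢
  linarith

theorem neg_log_le : -Real.log 0.6177 ≤ 0.48176 := by
  have h := Real.log_le_log one_pos one_le_exp_mul
  rw [Real.log_one, Real.log_mul (Real.exp_ne_zero _) (by norm_num), Real.log_exp] at h
  linarith

theorem mainTheorem6 :
    ∃ (V C : Type) (_ : Fintype V) (_ : Nonempty V) (_ : Fintype C) (_ : DecidableEq C)
      (E : Election V C) (k : ℕ),
      1 ≤ k ∧ k ≤ Fintype.card C ∧
        ∀ T : Finset C, E.IsGreedyCommittee k T →
          E.score T > 1.962 * (((Fintype.card C : ℝ) + 1) / ((k : ℝ) + 1)) := by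
  -- `k` is so large that `(k + 2) / (1 + K' * k)` is almost `1 / K'`, and `N` so large that
  -- rounding steps to whole levels is harmless even after `k` steps.
  obtain ⟨N, hN⟩ : ∃ N : ℕ, (N : ℝ) = 10 ^ 20 := ⟨10 ^ 20, by norm_num⟩
  obtain ⟨k, hk⟩ : ∃ k : ℕ, (k : ℝ) = 10 ^ 13 := ⟨10 ^ 13, by norm_num⟩
  have hN0 : N ≠ 0 := by
    rintro rfl
    norm_num at hN
  obtain ⟨q, hq, hqN⟩ : ∃ q : ℝ, 0 < q ∧ q ^ N = 0.6177 :=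
    ⟨0.6177 ^ (N : ℝ)⁻¹, by positivity, Real.rpow_inv_natCast_pow (by norm_num) hN0⟩
  have hq' : q < 1 := by
    by_contra! h
    have := one_le_pow₀ h (n := N)
    rw [hqN] at this
    norm_num at this
  have hlog : (N : ℝ) * (1 - q) ≤ 0.48176 := by
    have h1 := congrArg Real.log hqN
    rw [Real.log_pow] at h1
    have h2 := mul_le_mul_of_nonneg_left (Real.log_le_sub_one_of_pos hq) (Nat.cast_nonneg (α := ℝ) N)
    have h3 := neg_log_le
    linarith
  have he : 1 - q ≤ 1 / 10 ^ 20 := by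
    rw [hN] at hlog
    linarith
  -- With `η = 0.00001`, `K` is just above `η * (1 + 0.6177) / 4` and `K'` just above `c * K / (1 -
  -- c * K)`. A small `η` makes `K` small, which keeps the loss `(1 - c * K) ^ 2` negligible.
  obtain ⟨t, ht, hy⟩ := exists_schedule (q := q) (K := 0.00000404427) (c := 1.000001)
    (K' := 0.0000040443) (N := N) (k := k) hq' (by norm_num) (by linarith)
    (by rw [hqN]; nlinarith) (by norm_num) (by norm_num) (by norm_num) (by rw [hk]; linarith)
  refine ht.exists_election (η := 0.00001) (by norm_num) (by norm_num) hq hq' (by omega)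
    (by norm_num) (by norm_num) (by norm_num) (by rw [hqN]; linarith) (by rw [hqN]; norm_num)
    (by rw [hqN]; norm_num) ?_
  rw [hqN]
  rw [hk] at hy ⊢
  linarith
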